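/- Let $m,n$ be nonnegative integers, let $A,B$ be complex $m\times n$ matrices, let $2\le p<\infty$ and let $1\le k\le n$ be an integer. Let $\sigma_1(A)\ge\sigma_2(A)\ge\cdots\ge\sigma_{\min(m,n)}(A)\ge 0$ denote the singular values of $A$, with $\sigma_i(A)=0$ for $i>\min(m,n)$, and let $$\|A\|_{(p,k)}=\bigl(\sigma_1^p(A)+\cdots+\sigma_k^p(A)\bigr)^{1/p}$$ be the Ky Fan $p$-$k$ norm. Then $A$ is Birkhoff–James orthogonal to $B$ in this norm, that is, $$\|A+\lambda B\|_{(p,k)}\ge\|A\|_{(p,k)}\quad\text{for all }\lambda\in\mathbb{C},$$ if and only if there exist $k$ orthonormal vectors $v_1,\ldots,v_k\in\mathbb{C}^n$ satisfying $$A^*Av_i=\sigma_i^2(A)\,v_i\quad\text{for all }1\le i\le k$$ such that $$\sum_{i=1}^{k}\bigl\langle (A^*A)^{\frac{p-2}{2}}A^*B\,v_i,\,v_i\bigr\rangle=0,$$ where $\langle\cdot,\cdot\rangle$ is the standard inner product of $\mathbb{C}^n$, the power of the positive semidefinite matrix $A^*A$ is taken by functional calculus, and $(A^*A)^0=I$.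 -/

import Mathlib

open scoped Matrix MatrixOrder

/-- The `i`-th singular value of a complex matrix, in non-increasing order, indexed from `0`: it is
the square root of the `i`-th largest eigenvalue of `Aᴴ * A`, and `0` for `i ≥ min m n`. -/
noncomputable def matrixSingularValue {m n : ℕ} (A : Matrix (Fin m) (Fin n) ℂ) (i : ℕ) : ℝ :=
  (Matrix.toEuclideanLin A).singularValues i

/-- The Ky Fan `p`-`k` norm: the `ℓᵖ` norm of the `k` largest singular values. -/
noncomputable def kyFanNorm {m n : ℕ} (p : ℝ) (k : ℕ) (A : Matrix (Fin m) (Fin n) ℂ) : ℝ :=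
  (∑ i ∈ Finset.range k, matrixSingularValue A i ^ p) ^ (1 / p)

/-- Birkhoff–James orthogonality of `A` to `B` with respect to the Ky Fan `p`-`k` norm. -/
def KyFanBirkhoffJamesOrthogonal {m n : ℕ} (p : ℝ) (k : ℕ) (A B : Matrix (Fin m) (Fin n) ℂ) :
    Prop :=
  ∀ z : ℂ, kyFanNorm p k A ≤ kyFanNorm p k (A + z • B)

/-! Let `M = |A|^(p-2) A* B`. On a singular vector, `⟨M v, v⟩` is `σ^(p-2) ⟨B v, A v⟩`, so the
condition says that `tr (M P) = 0` for the projection `P` onto some span of top right singular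
vectors.

Two inequalities replace differentiation of the norm. Ky Fan's principle (`sum_norm_map_rpow_le`)
bounds `∑ ‖X v_i‖^p` over `k` orthonormal vectors by the top `k` singular values; Young's inequality
(`norm_rpow_sub_two_mul_inner_le`) is the tangent inequality of `‖·‖^p / p`. Together they give
sufficiency at once.

For necessity, apply them to singular vectors of `A + t z B` and let `t → 0+`. By compactness, each
complex `z` has a projection `P` of the above kind with `Re (z tr (M P)) ≥ 0`. The projection
depends on `z`, so pass to a compact convex set containing all of them: operators `0 ≤ H ≤ 1` of
trace `k` that are `1` above and `0` below the threshold `σ_k`. Hahn-Banach gives `tr (M H) = 0` for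
some such `H`.

It remains to make `H` a projection, as in the convexity of the `k`-numerical range. Maximize the
Hilbert-Schmidt norm on the slice with the same `tr (M H)`. Two eigenvalues in `(0, 1)` would leave
three real parameters of traceless perturbation against two real equations, contradicting
maximality; a single one is excluded by the integral trace. -/

section SingularSystem

variable {E F : Type*} [NormedAddCommGroup E] [InnerProductSpace ℂ E]
  [NormedAddCommGroup F] [InnerProductSpace ℂ F]

/-! ### Ky Fan's maximum principle and Young's inequality -/

theorem Fin.sum_ite_val_lt_eq_sum_castLE {n k : ℕ} {M : Type*} [AddCommMonoid M]
    (hkn : k ≤ n) (f : Fin n → M) :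
    ∑ j : Fin n, (if (j : ℕ) < k then f j else 0) = ∑ i : Fin k, f (Fin.castLE hkn i) := by
  obtain ⟨d, rfl⟩ := Nat.exists_eq_add_of_le hkn
  rw [Fin.sum_univ_add]
  simp
  rfl

/-- Subtracting the threshold `s (k - 1)` costs the same on both sides because the weights sum to
`k`; the comparison is then termwise. -/
theorem sum_mul_le_sum_castLE {n k : ℕ} (hkn : k ≤ n) {c s : Fin n → ℝ}
    (hc0 : ∀ j, 0 ≤ c j) (hc1 : ∀ j, c j ≤ 1) (hc : ∑ j, c j = k) (hs : Antitone s) :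
    ∑ j, c j * s j ≤ ∑ i : Fin k, s (Fin.castLE hkn i) := by
  rcases Nat.eq_zero_or_pos k with rfl | hk
  · have : ∀ j, c j = 0 := fun j =>
      (Finset.sum_eq_zero_iff_of_nonneg (fun j _ => hc0 j)).1 (by simpa using hc) j
        (Finset.mem_univ j)
    simp [this]
  set τ := s ⟨k - 1, by omega⟩ with hτ
  have key : ∑ j, c j * (s j - τ) ≤ ∑ i : Fin k, (s (Fin.castLE hkn i) - τ) := by
    rw [← Fin.sum_ite_val_lt_eq_sum_castLE hkn (fun j => s j - τ)]
    refine Finset.sum_le_sum fun j _ => ?_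
    split_ifs with hj
    · have : τ ≤ s j := hs (Fin.mk_le_mk.2 (by omega) : j ≤ ⟨k - 1, by omega⟩)
      nlinarith [hc1 j]
    · have : s j ≤ τ := hs (Fin.mk_le_mk.2 (by omega) : (⟨k - 1, by omega⟩ : Fin n) ≤ j)
      nlinarith [hc0 j]
  simp only [mul_sub, Finset.sum_sub_distrib, ← Finset.sum_mul, hc] at key
  simpa using key

/-- An orthonormal basis of right singular vectors, listed by non-increasing singular value. -/
structure IsSingularSystem {n : ℕ} (X : E →ₗ[ℂ] F) (e : OrthonormalBasis (Fin n) ℂ E)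
    (s : Fin n → ℝ) : Prop where
  antitone : Antitone s
  nonneg : ∀ i, 0 ≤ s i
  inner_map : ∀ i y, inner ℂ (X (e i)) (X y) = ((s i ^ 2 : ℝ) : ℂ) * inner ℂ (e i) y

namespace IsSingularSystem

variable {n : ℕ} {X : E →ₗ[ℂ] F} {e : OrthonormalBasis (Fin n) ℂ E} {s : Fin n → ℝ}

theorem norm_map (h : IsSingularSystem X e s) (i : Fin n) : ‖X (e i)‖ = s i := by
  have h1 := h.inner_map i (e i)
  rw [inner_self_eq_norm_sq_to_K, inner_self_eq_norm_sq_to_K] at h1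
  have h2 : ‖X (e i)‖ ^ 2 = s i ^ 2 := by
    have : ((‖X (e i)‖ ^ 2 : ℝ) : ℂ) = ((s i ^ 2 : ℝ) : ℂ) := by simpa using h1
    exact_mod_cast this
  exact (sq_eq_sq₀ (norm_nonneg _) (h.nonneg i)).1 h2

theorem norm_sq_map (h : IsSingularSystem X e s) (v : E) :
    ‖X v‖ ^ 2 = ∑ j, ‖inner ℂ (e j) v‖ ^ 2 * s j ^ 2 := by
  have h1 : inner ℂ (X v) (X v) = ∑ j, ((‖inner ℂ (e j) v‖ ^ 2 * s j ^ 2 : ℝ) : ℂ) := by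
    conv_lhs => enter [2]; rw [← e.sum_repr' v, map_sum]
    rw [sum_inner]
    refine Finset.sum_congr rfl fun j _ => ?_
    rw [map_smul, inner_smul_left, h.inner_map, mul_left_comm, RCLike.conj_mul]
    push_cast
    rw [mul_comm]
    rfl
  rw [inner_self_eq_norm_sq_to_K, ← Complex.ofReal_sum] at h1
  exact Complex.ofReal_injective (by rw [Complex.ofReal_pow]; exact h1)

theorem inner_eq_zero {e' : OrthonormalBasis (Fin n) ℂ E} (h : IsSingularSystem X e s)
    (h' : IsSingularSystem X e' s) {i j : Fin n} (hij : s i ≠ s j) :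
    inner ℂ (e i) (e' j) = 0 := by
  have h1 := h.inner_map i (e' j)
  have h2 := h'.inner_map j (e i)
  have h3 := congrArg (starRingEnd ℂ) h2
  rw [inner_conj_symm, map_mul, inner_conj_symm, Complex.conj_ofReal, h1] at h3
  have h4 : (((s i ^ 2 : ℝ) : ℂ) - ((s j ^ 2 : ℝ) : ℂ)) * inner ℂ (e i) (e' j) = 0 := by
    rw [sub_mul, h3, sub_self]
  rcases mul_eq_zero.1 h4 with h5 | h5
  · refine absurd ((sq_eq_sq₀ (h.nonneg i) (h.nonneg j)).1 ?_) hij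
    exact_mod_cast sub_eq_zero.1 h5
  · exact h5

/-- `‖X v‖ ^ 2` is the mean of the `s j ^ 2` with weights `‖⟨e j, v⟩‖ ^ 2`. Jensen for `x ^ (p / 2)`
applies since `p ≥ 2`. -/
theorem norm_map_rpow_le (h : IsSingularSystem X e s) {p : ℝ} (hp : 2 ≤ p) {v : E}
    (hv : ‖v‖ = 1) : ‖X v‖ ^ p ≤ ∑ j, ‖inner ℂ (e j) v‖ ^ 2 * s j ^ p := by
  have h1 : ∀ x : ℝ, 0 ≤ x → (x ^ 2) ^ (p / 2) = x ^ p := fun x hx => by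
    rw [← Real.rpow_natCast, ← Real.rpow_mul hx]
    congr 1
    push_cast
    ring
  rw [← h1 _ (norm_nonneg _), h.norm_sq_map]
  refine (Real.rpow_arith_mean_le_arith_mean_rpow Finset.univ (fun j => ‖inner ℂ (e j) v‖ ^ 2)
    (fun j => s j ^ 2) (fun _ _ => by positivity) ?_ (fun _ _ => by positivity)
    (by linarith)).trans_eq ?_
  · rw [e.sum_sq_norm_inner_right, hv, one_pow]
  · exact Finset.sum_congr rfl fun j _ => by rw [h1 _ (h.nonneg j)]

theorem sum_norm_map_rpow_le (h : IsSingularSystem X e s) {p : ℝ} (hp : 2 ≤ p) {k : ℕ}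
    (hkn : k ≤ n) {v : Fin k → E} (hv : Orthonormal ℂ v) :
    ∑ i, ‖X (v i)‖ ^ p ≤ ∑ i : Fin k, s (Fin.castLE hkn i) ^ p := by
  calc ∑ i, ‖X (v i)‖ ^ p ≤ ∑ i, ∑ j, ‖inner ℂ (e j) (v i)‖ ^ 2 * s j ^ p :=
        Finset.sum_le_sum fun i _ => h.norm_map_rpow_le hp (hv.1 i)
    _ = ∑ j, (∑ i, ‖inner ℂ (e j) (v i)‖ ^ 2) * s j ^ p := by
        rw [Finset.sum_comm]
        simp only [Finset.sum_mul]
    _ ≤ ∑ i : Fin k, s (Fin.castLE hkn i) ^ p := by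
        refine sum_mul_le_sum_castLE hkn (s := fun j => s j ^ p) (fun j => by positivity)
          (fun j => ?_) ?_ ?_
        -- Bessel's inequality for the unit vector `e j` bounds each weight by `1`.
        · have := hv.sum_inner_products_le (e j) (s := Finset.univ)
          rw [e.norm_eq_one, one_pow] at this
          simpa only [norm_inner_symm] using this
        · rw [Finset.sum_comm]
          simp [e.sum_sq_norm_inner_right, hv.1]
        · exact fun i j hij => Real.rpow_le_rpow (h.nonneg j) (h.antitone hij) (by linarith)

theorem sum_rpow_le {e' : OrthonormalBasis (Fin n) ℂ E} {s' : Fin n → ℝ}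
    (h : IsSingularSystem X e s) (h' : IsSingularSystem X e' s') {k : ℕ} (hkn : k ≤ n) :
    ∑ i : Fin k, s (Fin.castLE hkn i) ^ (2 : ℝ) ≤ ∑ i : Fin k, s' (Fin.castLE hkn i) ^ (2 : ℝ) := by
  have := h'.sum_norm_map_rpow_le le_rfl hkn
    (e.orthonormal.comp (Fin.castLE hkn) (Fin.castLE_injective hkn))
  simpa only [Function.comp, h.norm_map] using this

/-- Ky Fan's principle with exponent `2`, used both ways, equates all partial sums. This identifies
the values `‖A v_i‖` of a limit of singular systems. -/
theorem values_unique {e' : OrthonormalBasis (Fin n) ℂ E} {s' : Fin n → ℝ}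
    (h : IsSingularSystem X e s) (h' : IsSingularSystem X e' s') : s = s' := by
  have key : ∀ (k : ℕ) (hkn : k ≤ n), ∑ i : Fin k, s (Fin.castLE hkn i) ^ (2 : ℝ) =
      ∑ i : Fin k, s' (Fin.castLE hkn i) ^ (2 : ℝ) :=
    fun k hkn => le_antisymm (h.sum_rpow_le h' hkn) (h'.sum_rpow_le h hkn)
  funext i
  have h1 := key i i.2.le
  have h2 := key (i + 1) i.2
  rw [Fin.sum_univ_castSucc, Fin.sum_univ_castSucc] at h2
  have h3 := (add_right_inj _).1 ((congrArg (· + _) h1).symm.trans h2)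
  exact (Real.rpow_left_inj (h.nonneg i) (h'.nonneg i) two_ne_zero).1 h3

end IsSingularSystem

theorem norm_rpow_sub_two_mul_inner_self {p : ℝ} (hp : 2 ≤ p) (a : F) :
    ‖a‖ ^ (p - 2) * (inner ℂ a a).re = ‖a‖ ^ p := by
  have : (inner ℂ a a).re = ‖a‖ ^ 2 := inner_self_eq_norm_sq (𝕜 := ℂ) a
  rw [this]
  rcases eq_or_ne a 0 with rfl | ha
  · simp [Real.zero_rpow (by linarith : p ≠ 0)]
  · rw [← Real.rpow_natCast, ← Real.rpow_add (norm_pos_iff.2 ha)]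
    norm_num

/-- Cauchy-Schwarz, then Young with the conjugate exponents `p / (p - 1)` and `p`. Equality holds at
`a = b`. -/
theorem norm_rpow_sub_two_mul_inner_le {p : ℝ} (hp : 2 ≤ p) (a b : F) :
    ‖a‖ ^ (p - 2) * (inner ℂ a b).re ≤ (1 - 1 / p) * ‖a‖ ^ p + 1 / p * ‖b‖ ^ p := by
  have hp0 : 0 < p := by linarith
  have hp1 : 0 < p - 1 := by linarith
  have h1 : ‖a‖ ^ (p - 2) * (inner ℂ a b).re ≤ ‖a‖ ^ (p - 1) * ‖b‖ := by
    rcases eq_or_ne a 0 with rfl | ha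
    · simp [Real.zero_rpow hp1.ne']
    · calc ‖a‖ ^ (p - 2) * (inner ℂ a b).re ≤ ‖a‖ ^ (p - 2) * (‖a‖ * ‖b‖) := by
            gcongr
            exact re_inner_le_norm (𝕜 := ℂ) a b
        _ = ‖a‖ ^ (p - 1) * ‖b‖ := by
            rw [← mul_assoc, ← Real.rpow_add_one (norm_pos_iff.2 ha).ne']
            congr 2
            ring
  refine h1.trans ?_
  have hpq : Real.HolderConjugate (p / (p - 1)) p := by
    rw [Real.holderConjugate_iff]
    refine ⟨by rw [lt_div_iff₀ hp1]; linarith, by field_simp; ring⟩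
  refine (Real.young_inequality_of_nonneg (by positivity) (norm_nonneg b) hpq).trans_eq ?_
  rw [← Real.rpow_mul (norm_nonneg a), mul_div_cancel₀ _ hp1.ne']
  field_simp

end SingularSystem

/-! ### Limits of singular systems along a direction -/

section Limit

variable {m n : ℕ}

theorem exists_isSingularSystem (A : Matrix (Fin m) (Fin n) ℂ) :
    ∃ e : OrthonormalBasis (Fin n) ℂ (EuclideanSpace ℂ (Fin n)),
      IsSingularSystem (Matrix.toEuclideanLin A) e fun i => matrixSingularValue A i := by
  set T := Matrix.toEuclideanLin A with hT
  have hn : Module.finrank ℂ (EuclideanSpace ℂ (Fin n)) = n := by simp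
  refine ⟨T.isSymmetric_adjoint_comp_self.eigenvectorBasis hn, ?_, ?_, ?_⟩
  · exact fun i j hij => T.singularValues_antitone (Fin.le_def.1 hij)
  · exact fun i => T.singularValues_nonneg i
  · intro i y
    rw [← LinearMap.adjoint_inner_left, ← LinearMap.comp_apply,
      LinearMap.IsSymmetric.apply_eigenvectorBasis, inner_smul_left]
    congr 1
    rw [← T.sq_singularValues_fin hn i]
    exact Complex.conj_ofReal _

theorem exists_tendsto_orthonormalBasis {E : Type*} [NormedAddCommGroup E]
    [InnerProductSpace ℂ E] [FiniteDimensional ℂ E]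
    (e : ℕ → OrthonormalBasis (Fin n) ℂ E) :
    ∃ (v : OrthonormalBasis (Fin n) ℂ E) (φ : ℕ → ℕ), StrictMono φ ∧
      ∀ i, Filter.Tendsto (fun l => e (φ l) i) Filter.atTop (nhds (v i)) := by
  have : ProperSpace E := FiniteDimensional.proper ℂ E
  obtain ⟨v, -, φ, hφ, hv⟩ := (isCompact_closedBall (0 : Fin n → E) 1).tendsto_subseq
    (x := fun l => ⇑(e l)) fun l => by
      rw [mem_closedBall_zero_iff, pi_norm_le_iff_of_nonneg zero_le_one]
      exact fun i => ((e l).norm_eq_one i).le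
  have hv' := tendsto_pi_nhds.1 hv
  have hon : Orthonormal ℂ v := by
    classical
    rw [orthonormal_iff_ite]
    intro i j
    have h1 := (hv' i).inner (𝕜 := ℂ) (hv' j)
    refine tendsto_nhds_unique h1 ?_
    simp only [Function.comp, orthonormal_iff_ite.1 (e _).orthonormal i j]
    exact tendsto_const_nhds
  have hcard : Fintype.card (Fin n) = Module.finrank ℂ E :=
    (Module.finrank_eq_card_basis (e 0).toBasis).symm
  refine ⟨OrthonormalBasis.mk hon
    (hon.linearIndependent.span_eq_top_of_card_eq_finrank' hcard).ge, φ, hφ, fun i => ?_⟩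
  rw [OrthonormalBasis.coe_mk]
  exact hv' i

/-- If the norm does not decrease at `A` in the direction `C`, then some system of right singular
vectors of `A` has nonnegative one-sided derivative in the direction `C`. -/
theorem exists_isSingularSystem_re_nonneg {p : ℝ} (hp : 2 ≤ p) {k : ℕ} (hkn : k ≤ n)
    (A C : Matrix (Fin m) (Fin n) ℂ)
    (h : ∀ t : ℝ, 0 < t → ∑ i : Fin k, matrixSingularValue A i ^ p ≤
      ∑ i : Fin k, matrixSingularValue (A + (t : ℂ) • C) i ^ p) :
    ∃ v : OrthonormalBasis (Fin n) ℂ (EuclideanSpace ℂ (Fin n)),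
      IsSingularSystem (Matrix.toEuclideanLin A) v (fun i => matrixSingularValue A i) ∧
      0 ≤ ∑ i : Fin k, matrixSingularValue A i ^ (p - 2) *
        (inner ℂ (Matrix.toEuclideanLin A (v (Fin.castLE hkn i)))
          (Matrix.toEuclideanLin C (v (Fin.castLE hkn i)))).re := by
  set t : ℕ → ℝ := fun l => 1 / ((l : ℝ) + 1) with ht
  have ht0 : ∀ l, 0 < t l := fun l => by positivity
  set X : ℕ → Matrix (Fin m) (Fin n) ℂ := fun l => A + (t l : ℂ) • C with hX
  choose e he using fun l => exists_isSingularSystem (X l)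
  obtain ⟨v, φ, hφ, hv⟩ := exists_tendsto_orthonormalBasis e
  have hXapp : ∀ l x, Matrix.toEuclideanLin (X l) x =
      Matrix.toEuclideanLin A x + (t l : ℂ) • Matrix.toEuclideanLin C x := fun l x => by
    rw [hX, map_add, map_smul, LinearMap.add_apply, LinearMap.smul_apply]
  have htφ : Filter.Tendsto (fun l => ((t (φ l) : ℝ) : ℂ)) Filter.atTop (nhds 0) := by
    have := tendsto_one_div_add_atTop_nhds_zero_nat (𝕜 := ℝ)
    rw [← Complex.ofReal_zero]
    exact (Complex.continuous_ofReal.tendsto _).comp (this.comp hφ.tendsto_atTop)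
  have hcont : ∀ D : Matrix (Fin m) (Fin n) ℂ, Continuous (Matrix.toEuclideanLin D) :=
    fun D => LinearMap.continuous_of_finiteDimensional _
  have hD : ∀ (D : Matrix (Fin m) (Fin n) ℂ) i, Filter.Tendsto
      (fun l => Matrix.toEuclideanLin D (e (φ l) i)) Filter.atTop
      (nhds (Matrix.toEuclideanLin D (v i))) :=
    fun D i => ((hcont D).tendsto _).comp (hv i)
  have hXv : ∀ i, Filter.Tendsto (fun l => Matrix.toEuclideanLin (X (φ l)) (e (φ l) i))
      Filter.atTop (nhds (Matrix.toEuclideanLin A (v i))) := fun i => by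
    have := (hD A i).add (htφ.smul (hD C i))
    simpa only [hXapp, zero_smul, add_zero] using this
  have hXy : ∀ y, Filter.Tendsto (fun l => Matrix.toEuclideanLin (X (φ l)) y)
      Filter.atTop (nhds (Matrix.toEuclideanLin A y)) := fun y => by
    have := (tendsto_const_nhds (x := Matrix.toEuclideanLin A y)).add
      (htφ.smul_const (Matrix.toEuclideanLin C y))
    simpa only [hXapp, zero_smul, add_zero] using this
  -- Order and eigenvector relations are closed conditions, so they survive the limit once the
  -- values are written as norms.
  have hsys : IsSingularSystem (Matrix.toEuclideanLin A) v
      (fun i => ‖Matrix.toEuclideanLin A (v i)‖) := by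
    refine ⟨fun i j hij => ?_, fun i => norm_nonneg _, fun i y => ?_⟩
    · refine le_of_tendsto_of_tendsto' (hXv j).norm (hXv i).norm fun l => ?_
      rw [(he _).norm_map, (he _).norm_map]
      exact (he _).antitone hij
    · have h1 := (hXv i).inner (𝕜 := ℂ) (hXy y)
      have h2 := ((Complex.continuous_ofReal.tendsto _).comp ((hXv i).norm.pow 2)).mul
        ((hv i).inner (𝕜 := ℂ) (tendsto_const_nhds (x := y)))
      refine tendsto_nhds_unique h1 (h2.congr fun l => ?_)
      rw [(he _).inner_map i y, ← (he _).norm_map]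
      rfl
  obtain ⟨a, ha⟩ := exists_isSingularSystem A
  have hval : ∀ i, ‖Matrix.toEuclideanLin A (v i)‖ = matrixSingularValue A i :=
    congrFun (hsys.values_unique ha)
  refine ⟨v, by simpa only [hval] using hsys, ?_⟩
  have hlim : Filter.Tendsto (fun l => ∑ i : Fin k,
      ‖Matrix.toEuclideanLin (X (φ l)) (e (φ l) (Fin.castLE hkn i))‖ ^ (p - 2) *
        (inner ℂ (Matrix.toEuclideanLin (X (φ l)) (e (φ l) (Fin.castLE hkn i)))
          (Matrix.toEuclideanLin C (e (φ l) (Fin.castLE hkn i)))).re) Filter.atTop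
      (nhds (∑ i : Fin k, ‖Matrix.toEuclideanLin A (v (Fin.castLE hkn i))‖ ^ (p - 2) *
        (inner ℂ (Matrix.toEuclideanLin A (v (Fin.castLE hkn i)))
          (Matrix.toEuclideanLin C (v (Fin.castLE hkn i)))).re)) := by
    refine tendsto_finsetSum _ fun i _ => Filter.Tendsto.mul ?_ ?_
    · exact (hXv _).norm.rpow_const (Or.inr (by linarith))
    · exact (Complex.continuous_re.tendsto _).comp ((hXv _).inner (hD C _))
  simp only [hval, Fin.val_castLE] at hlim
  refine ge_of_tendsto' hlim fun l => ?_
  set w : Fin k → EuclideanSpace ℂ (Fin n) := fun i => e (φ l) (Fin.castLE hkn i) with hw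
  have hwon : Orthonormal ℂ w := (e (φ l)).orthonormal.comp _ (Fin.castLE_injective hkn)
  have hle : ∑ i, ‖Matrix.toEuclideanLin A (w i)‖ ^ p ≤
      ∑ i, ‖Matrix.toEuclideanLin (X (φ l)) (w i)‖ ^ p := by
    refine (ha.sum_norm_map_rpow_le hp hkn hwon).trans ((h _ (ht0 (φ l))).trans_eq ?_)
    exact Finset.sum_congr rfl fun i _ => by rw [(he _).norm_map]; rfl
  -- Young is based at `X w`, not at `A w`: substituting `A = X - t C` below leaves `t` times the
  -- desired sum, which is therefore nonnegative.
  have hyoung : ∑ i, ‖Matrix.toEuclideanLin (X (φ l)) (w i)‖ ^ (p - 2) *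
      (inner ℂ (Matrix.toEuclideanLin (X (φ l)) (w i)) (Matrix.toEuclideanLin A (w i))).re ≤
      ∑ i, ‖Matrix.toEuclideanLin (X (φ l)) (w i)‖ ^ p := by
    refine (Finset.sum_le_sum fun i _ => norm_rpow_sub_two_mul_inner_le hp _ _).trans ?_
    rw [Finset.sum_add_distrib, ← Finset.mul_sum, ← Finset.mul_sum]
    have : 0 ≤ 1 / p := by positivity
    nlinarith
  have hA : ∀ x, Matrix.toEuclideanLin A x =
      Matrix.toEuclideanLin (X (φ l)) x - (t (φ l) : ℂ) • Matrix.toEuclideanLin C x := fun x => by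
    rw [hXapp, add_sub_cancel_right]
  simp only [hA, inner_sub_right, inner_smul_right, Complex.sub_re, Complex.re_ofReal_mul, mul_sub,
    norm_rpow_sub_two_mul_inner_self hp, Finset.sum_sub_distrib, mul_left_comm _ (t (φ l)),
    ← Finset.mul_sum] at hyoung
  have := ht0 (φ l)
  exact nonneg_of_mul_nonneg_right (by linarith) this

end Limit

/-! ### The compact convex set of fractional projections -/

section Fractional

variable {E : Type*} [NormedAddCommGroup E] [InnerProductSpace ℂ E]

/-- The symmetric operators `H` with `0 ≤ H ≤ 1` and trace `k` that fix the vectors of `U` and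
annihilate those of `V`: the convex hull of the orthogonal projections with these properties. -/
def fractionalProjections (k : ℕ) (U V : Set E) : Set (E →L[ℂ] E) :=
  {H | (∀ x y, inner ℂ (H x) y = inner ℂ x (H y)) ∧
    (∀ x, 0 ≤ (inner ℂ (H x) x).re ∧ (inner ℂ (H x) x).re ≤ ‖x‖ ^ 2) ∧
    LinearMap.trace ℂ E H = k ∧ (∀ x ∈ U, H x = x) ∧ ∀ x ∈ V, H x = 0}

/-- The real-linear functional `H ↦ tr (M H)`. -/
noncomputable def traceMul (M : E →ₗ[ℂ] E) : (E →L[ℂ] E) →ₗ[ℝ] ℂ :=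
  ((LinearMap.trace ℂ E ∘ₗ LinearMap.mulLeft ℂ M) ∘ₗ
    ContinuousLinearMap.coeLM ℂ).restrictScalars ℝ

theorem traceMul_apply (M : E →ₗ[ℂ] E) (H : E →L[ℂ] E) :
    traceMul M H = LinearMap.trace ℂ E (M ∘ₗ H) := rfl

theorem traceMul_eq_sum {ι : Type*} [Fintype ι] (M : E →ₗ[ℂ] E) (H : E →L[ℂ] E)
    (b : OrthonormalBasis ι ℂ E) : traceMul M H = ∑ j, inner ℂ (b j) (M (H (b j))) := by
  rw [traceMul_apply, LinearMap.trace_eq_sum_inner _ b]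
  rfl

theorem traceMul_id (H : E →L[ℂ] E) : traceMul LinearMap.id H = LinearMap.trace ℂ E H := rfl

theorem continuous_traceMul [FiniteDimensional ℂ E] (M : E →ₗ[ℂ] E) : Continuous (traceMul M) := by
  have hM : Continuous M := LinearMap.continuous_of_finiteDimensional _
  rw [funext fun H => traceMul_eq_sum M H (stdOrthonormalBasis ℂ E)]
  fun_prop

variable {k : ℕ} {U V : Set E}

theorem convex_fractionalProjections : Convex ℝ (fractionalProjections k U V) := by
  rintro H ⟨h1, h2, h3, h4, h5⟩ K ⟨g1, g2, g3, g4, g5⟩ a b ha hb hab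
  have hinner : ∀ x y, inner ℂ ((a • H + b • K) x) y =
      a * inner ℂ (H x) y + b * inner ℂ (K x) y := fun x y => by
    simp
  refine ⟨fun x y => ?_, fun x => ?_, ?_, fun x hx => ?_, fun x hx => ?_⟩
  · rw [hinner, h1, g1]
    simp
  · rw [hinner, Complex.add_re, Complex.re_ofReal_mul, Complex.re_ofReal_mul]
    obtain ⟨p1, p2⟩ := h2 x
    obtain ⟨q1, q2⟩ := g2 x
    refine ⟨by positivity, ?_⟩
    calc _ ≤ a * ‖x‖ ^ 2 + b * ‖x‖ ^ 2 := by gcongr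
      _ = ‖x‖ ^ 2 := by rw [← add_mul, hab, one_mul]
  · rw [← traceMul_id] at h3 g3 ⊢
    rw [map_add, map_smul, map_smul, h3, g3, ← add_smul, hab, one_smul]
  · simp [h4 x hx, g4 x hx, ← add_smul, hab]
  · simp [h5 x hx, g5 x hx]

variable [FiniteDimensional ℂ E]

theorem isCompact_fractionalProjections : IsCompact (fractionalProjections k U V) := by
  have : ProperSpace (E →L[ℂ] E) := FiniteDimensional.proper ℂ _
  have hcl : IsClosed (fractionalProjections k U V) := by
    have e1 : ∀ x : E, Continuous fun H : E →L[ℂ] E => H x := fun x => by fun_prop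
    simp only [fractionalProjections, Set.ofPred_and, Set.ofPred_forall]
    refine IsClosed.inter ?_ (IsClosed.inter ?_ (IsClosed.inter ?_ (IsClosed.inter ?_ ?_)))
    · exact isClosed_iInter fun x => isClosed_iInter fun y =>
        isClosed_eq ((e1 x).inner continuous_const) (continuous_const.inner (e1 y))
    · exact isClosed_iInter fun x => IsClosed.inter
        (isClosed_le continuous_const (Complex.continuous_re.comp ((e1 x).inner continuous_const)))
        (isClosed_le (Complex.continuous_re.comp ((e1 x).inner continuous_const)) continuous_const)
    · exact isClosed_eq (continuous_traceMul LinearMap.id) continuous_const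
    · exact isClosed_iInter fun x => isClosed_iInter fun _ => isClosed_eq (e1 x) continuous_const
    · exact isClosed_iInter fun x => isClosed_iInter fun _ => isClosed_eq (e1 x) continuous_const
  refine (isCompact_closedBall (0 : E →L[ℂ] E) 1).of_isClosed_subset hcl ?_
  rintro H ⟨h1, h2, -⟩
  rw [mem_closedBall_zero_iff]
  refine H.opNorm_le_bound zero_le_one fun x => ?_
  rw [one_mul]
  refine le_of_sq_le_sq (le_trans ?_ (h2 x).2) (norm_nonneg x)
  -- Positivity at `x - H x` and `H ≤ 1` at `H x` give `‖H x‖ ^ 2 ≤ ⟨H x, x⟩`.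
  have p1 := (h2 (x - H x)).1
  have p2 := (h2 (H x)).2
  have p3 : (inner ℂ (H x) (H x)).re = ‖H x‖ ^ 2 := inner_self_eq_norm_sq (𝕜 := ℂ) (H x)
  have p4 : inner ℂ (H (H x)) x = inner ℂ (H x) (H x) := h1 _ _
  simp only [map_sub, inner_sub_left, inner_sub_right, Complex.sub_re, p4, p3] at p1
  linarith

/-- If every direction of the plane is met by the compact convex set of values `tr (M H)`, then the
value `0` is attained. -/
theorem exists_traceMul_eq_zero (M : E →ₗ[ℂ] E)
    (h : ∀ z : ℂ, ∃ H ∈ fractionalProjections k U V, 0 ≤ (z * traceMul M H).re) :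
    ∃ H ∈ fractionalProjections k U V, traceMul M H = 0 := by
  by_contra! hne
  have hconv : Convex ℝ (traceMul M '' fractionalProjections k U V) :=
    convex_fractionalProjections.linear_image (traceMul M)
  have hcl : IsClosed (traceMul M '' fractionalProjections k U V) :=
    (isCompact_fractionalProjections.image (continuous_traceMul M)).isClosed
  obtain ⟨f, u, hu, hf⟩ := geometric_hahn_banach_point_closed hconv hcl
    (show (0 : ℂ) ∉ _ by rintro ⟨H, hH, h0⟩; exact hne H hH h0)
  rw [map_zero] at hu
  -- A real functional on `ℂ` is `w ↦ Re (ζ w)`; the hypothesis at `-ζ` contradicts strict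
  -- separation from `0`.
  have hfz : ∀ w : ℂ, f w = ((⟨f 1, - f Complex.I⟩ : ℂ) * w).re := fun w => by
    have hw : w = w.re • (1 : ℂ) + w.im • Complex.I := by
      simp
    conv_lhs => rw [hw, map_add, map_smul, map_smul]
    simp [Complex.mul_re]
    ring
  obtain ⟨H, hH, h0⟩ := h (-⟨f 1, - f Complex.I⟩)
  have := hf _ ⟨H, hH, rfl⟩
  rw [hfz] at this
  rw [neg_mul, Complex.neg_re] at h0
  linarith

end Fractional

/-! ### Traceless perturbations of a plane -/

section PlanePerturbation

variable {E : Type*} [NormedAddCommGroup E] [InnerProductSpace ℂ E]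

/-- The traceless symmetric operators on the plane spanned by `a` and `b`. -/
noncomputable def planePerturbation (a b : E) : ℝ × ℂ →ₗ[ℝ] E →L[ℂ] E where
  toFun c := ((c.1 : ℂ) • innerSL ℂ a + c.2 • innerSL ℂ b).smulRight a +
    (starRingEnd ℂ c.2 • innerSL ℂ a - (c.1 : ℂ) • innerSL ℂ b).smulRight b
  map_add' c d := by
    ext x
    simp
    module
  map_smul' r c := by
    ext x
    simp
    module

theorem planePerturbation_apply (a b : E) (c : ℝ × ℂ) (x : E) :
    planePerturbation a b c x = (c.1 * inner ℂ a x + c.2 * inner ℂ b x) • a +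
      (starRingEnd ℂ c.2 * inner ℂ a x - c.1 * inner ℂ b x) • b := by
  simp [planePerturbation]

theorem inner_planePerturbation_left (a b : E) (c : ℝ × ℂ) (x y : E) :
    inner ℂ (planePerturbation a b c x) y = inner ℂ x (planePerturbation a b c y) := by
  simp only [planePerturbation_apply, inner_add_left, inner_add_right, inner_smul_left,
    inner_smul_right, map_add, map_sub, map_mul, inner_conj_symm, Complex.conj_ofReal,
    Complex.conj_conj]
  ring

theorem abs_re_inner_planePerturbation_le (a b : E) (c : ℝ × ℂ) (x : E) :
    |(inner ℂ (planePerturbation a b c x) x).re| ≤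
      (|c.1| + ‖c.2‖) * (‖inner ℂ a x‖ ^ 2 + ‖inner ℂ b x‖ ^ 2) := by
  refine (Complex.abs_re_le_norm _).trans ?_
  have h1 : ‖inner ℂ (planePerturbation a b c x) x‖ ≤
      (|c.1| * ‖inner ℂ a x‖ + ‖c.2‖ * ‖inner ℂ b x‖) * ‖inner ℂ a x‖ +
        (‖c.2‖ * ‖inner ℂ a x‖ + |c.1| * ‖inner ℂ b x‖) * ‖inner ℂ b x‖ := by
    rw [planePerturbation_apply, inner_add_left, inner_smul_left, inner_smul_left]
    refine (norm_add_le _ _).trans (add_le_add ?_ ?_)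
    · rw [norm_mul, RCLike.norm_conj]
      gcongr
      refine (norm_add_le _ _).trans_eq ?_
      simp
    · rw [norm_mul, RCLike.norm_conj]
      gcongr
      refine (norm_sub_le _ _).trans_eq ?_
      simp
  refine h1.trans ?_
  nlinarith [norm_nonneg c.2, sq_nonneg (‖inner ℂ a x‖ - ‖inner ℂ b x‖),
    mul_nonneg (norm_nonneg c.2) (sq_nonneg (‖inner ℂ a x‖ - ‖inner ℂ b x‖))]

theorem trace_planePerturbation [FiniteDimensional ℂ E] {a b : E} (ha : ‖a‖ = 1) (hb : ‖b‖ = 1)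
    (hab : inner ℂ a b = 0) (c : ℝ × ℂ) :
    LinearMap.trace ℂ E (planePerturbation a b c) = 0 := by
  have h1 : ∀ (f : E →L[ℂ] ℂ) (x : E), traceMul LinearMap.id (f.smulRight x) = f x :=
    fun f x => LinearMap.trace_smulRight (f : E →ₗ[ℂ] ℂ) x
  have hba : inner ℂ b a = 0 := by rw [← inner_conj_symm, hab, map_zero]
  rw [← traceMul_id, planePerturbation]
  simp [h1, hab, hba, inner_self_eq_norm_sq_to_K, ha, hb]

theorem planePerturbation_eq_zero {a b : E} (ha : ‖a‖ = 1) (hb : ‖b‖ = 1)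
    (hab : inner ℂ a b = 0) {c : ℝ × ℂ} (h : planePerturbation a b c a = 0) : c = 0 := by
  have hba : inner ℂ b a = 0 := by rw [← inner_conj_symm, hab, map_zero]
  have h1 := congrArg (inner ℂ a) h
  have h2 := congrArg (inner ℂ b) h
  simp [planePerturbation_apply, hab, hba,
    inner_self_eq_norm_sq_to_K, ha, hb] at h1 h2
  exact Prod.ext h1 h2

end PlanePerturbation

/-! ### Perturbing within the set of fractional projections -/

section Projection

variable {E : Type*} [NormedAddCommGroup E] [InnerProductSpace ℂ E]
  {k : ℕ} {U V : Set E} {H : E →L[ℂ] E}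

theorem fractionalProjections.isSymmetric (hH : H ∈ fractionalProjections k U V) :
    (H : E →ₗ[ℂ] E).IsSymmetric := hH.1

variable {n : ℕ} {u : OrthonormalBasis (Fin n) ℂ E} {h : Fin n → ℝ}

theorem re_inner_map_eq_sum (hu : ∀ j, H (u j) = (h j : ℂ) • u j) (x : E) :
    (inner ℂ (H x) x).re = ∑ j, h j * ‖inner ℂ (u j) x‖ ^ 2 := by
  conv_lhs => enter [1, 2]; rw [← u.sum_repr' x, map_sum]
  rw [sum_inner, Complex.re_sum]
  refine Finset.sum_congr rfl fun j _ => ?_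
  rw [map_smul, hu, inner_smul_left, inner_smul_left, mul_left_comm, RCLike.conj_mul,
    Complex.conj_ofReal, Complex.re_ofReal_mul]
  congr 1
  norm_cast

variable [FiniteDimensional ℂ E]

/-- `u a` and `u b` are orthogonal to the eigenspaces of `0` and `1`, so the perturbation vanishes
on `U` and `V`. Its quadratic form is absorbed by the slack of `h a` and `h b` in `[0, 1]`. -/
theorem add_smul_planePerturbation_mem (hH : H ∈ fractionalProjections k U V)
    (hu : ∀ j, H (u j) = (h j : ℂ) • u j) {a b : Fin n} (hab : a ≠ b)
    (ha0 : h a ≠ 0) (ha1 : h a ≠ 1) (hb0 : h b ≠ 0) (hb1 : h b ≠ 1) (c : ℝ × ℂ)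
    {ε : ℝ} (hεa : |ε| * (|c.1| + ‖c.2‖) ≤ min (h a) (1 - h a))
    (hεb : |ε| * (|c.1| + ‖c.2‖) ≤ min (h b) (1 - h b)) :
    H + ε • planePerturbation (u a) (u b) c ∈ fractionalProjections k U V := by
  set K := planePerturbation (u a) (u b) c with hK
  have hinner : ∀ x y, inner ℂ ((H + ε • K) x) y = inner ℂ (H x) y + ε * inner ℂ (K x) y :=
    fun x y => by simp
  have hfix : ∀ (i : Fin n) (t : ℝ) (x : E), h i ≠ t → H x = (t : ℂ) • x →
      inner ℂ (u i) x = 0 := fun i t x hi hx => by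
    have h1 := hH.1 (u i) x
    rw [hu, hx, inner_smul_left, inner_smul_right, Complex.conj_ofReal, ← sub_eq_zero, ← sub_mul,
      ← Complex.ofReal_sub] at h1
    exact (mul_eq_zero.1 h1).resolve_left (by simpa [sub_eq_zero] using hi)
  have hKx : ∀ (t : ℝ) (x : E), h a ≠ t → h b ≠ t → H x = (t : ℂ) • x → K x = 0 :=
    fun t x hat hbt hx => by
      rw [hK, planePerturbation_apply, hfix a t x hat hx, hfix b t x hbt hx]
      simp
  have hunit : ∀ j, (inner ℂ (H (u j)) (u j)).re = h j := fun j => by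
    rw [hu, inner_smul_left, Complex.conj_ofReal, Complex.re_ofReal_mul]
    simp [inner_self_eq_norm_sq_to_K]
  have h0 : ∀ j, 0 ≤ h j := fun j => by simpa [hunit] using (hH.2.1 (u j)).1
  have h1 : ∀ j, h j ≤ 1 := fun j => by simpa [hunit] using (hH.2.1 (u j)).2
  refine ⟨fun x y => ?_, fun x => ?_, ?_, fun x hx => ?_, fun x hx => ?_⟩
  · rw [hinner, hH.1, inner_planePerturbation_left]
    simp [hK]
  · rw [hinner, Complex.add_re, Complex.re_ofReal_mul, re_inner_map_eq_sum hu]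
    have hbd : |ε * (inner ℂ (K x) x).re| ≤
        |ε| * (|c.1| + ‖c.2‖) * (‖inner ℂ (u a) x‖ ^ 2 + ‖inner ℂ (u b) x‖ ^ 2) := by
      rw [abs_mul, mul_assoc]
      gcongr
      exact abs_re_inner_planePerturbation_le _ _ _ _
    have hlow := Finset.add_le_sum (f := fun j => h j * ‖inner ℂ (u j) x‖ ^ 2)
      (fun j _ => mul_nonneg (h0 j) (sq_nonneg _)) (Finset.mem_univ a) (Finset.mem_univ b) hab
    have hupp := Finset.add_le_sum (f := fun j => (1 - h j) * ‖inner ℂ (u j) x‖ ^ 2)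
      (fun j _ => mul_nonneg (sub_nonneg.2 (h1 j)) (sq_nonneg _)) (Finset.mem_univ a)
      (Finset.mem_univ b) hab
    have hsum : ∑ j, (1 - h j) * ‖inner ℂ (u j) x‖ ^ 2 =
        ‖x‖ ^ 2 - ∑ j, h j * ‖inner ℂ (u j) x‖ ^ 2 := by
      rw [← u.sum_sq_norm_inner_right x, ← Finset.sum_sub_distrib]
      exact Finset.sum_congr rfl fun j _ => by ring
    rw [hsum] at hupp
    obtain ⟨p1, p2⟩ := abs_le.1 hbd
    obtain ⟨qa, ra⟩ := le_min_iff.1 hεa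
    obtain ⟨qb, rb⟩ := le_min_iff.1 hεb
    have sa := sq_nonneg ‖inner ℂ (u a) x‖
    have sb := sq_nonneg ‖inner ℂ (u b) x‖
    have e1 := mul_le_mul_of_nonneg_right qa sa
    have e2 := mul_le_mul_of_nonneg_right ra sa
    have e3 := mul_le_mul_of_nonneg_right qb sb
    have e4 := mul_le_mul_of_nonneg_right rb sb
    constructor <;> linarith
  · have := trace_planePerturbation (u.norm_eq_one a) (u.norm_eq_one b) (u.orthonormal.2 hab) c
    have hHt := hH.2.2.1
    rw [← traceMul_id] at this hHt ⊢
    rw [map_add, map_smul, this, hHt, smul_zero, add_zero]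
  · have hx' := hH.2.2.2.1 x hx
    simp [hx', hKx 1 x ha1 hb1 (by simpa using hx')]
  · have hx' := hH.2.2.2.2 x hx
    simp [hx', hKx 0 x ha0 hb0 (by simpa using hx')]

end Projection

/-! ### From fractional projections to orthonormal vectors -/

section Extreme

variable {E : Type*} [NormedAddCommGroup E] [InnerProductSpace ℂ E] [FiniteDimensional ℂ E]
  {k : ℕ} {U V : Set E} {H : E →L[ℂ] E}
  {n : ℕ} {u : OrthonormalBasis (Fin n) ℂ E} {h : Fin n → ℝ}

/-- An element of the slice `tr (M ·) = tr (M H)` with the largest Hilbert-Schmidt norm has at most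
one eigenvalue other than `0` and `1`. -/
theorem eigenvalue_eq_zero_or_one_of_isMaxOn {ι : Type*} [Fintype ι]
    (b₀ : OrthonormalBasis ι ℂ E) (M : E →ₗ[ℂ] E) (hH : H ∈ fractionalProjections k U V)
    (hmax : IsMaxOn (fun K : E →L[ℂ] E => ∑ j, ‖K (b₀ j)‖ ^ 2)
      (fractionalProjections k U V ∩ {K | traceMul M K = traceMul M H}) H)
    (hu : ∀ j, H (u j) = (h j : ℂ) • u j) (h0 : ∀ j, 0 ≤ h j) (h1 : ∀ j, h j ≤ 1)
    {a b : Fin n} (hab : a ≠ b) (ha0 : h a ≠ 0) (ha1 : h a ≠ 1) : h b = 0 ∨ h b = 1 := by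
  by_contra! hb
  obtain ⟨hb0, hb1⟩ := hb
  -- A real-linear map from dimension `3` to dimension `2` has a nonzero kernel.
  obtain ⟨c, hc, hc0⟩ := (Submodule.ne_bot_iff _).1 (LinearMap.ker_ne_bot_of_finrank_lt
    (f := traceMul M ∘ₗ planePerturbation (u a) (u b)) (by simp [Complex.finrank_real_complex]))
  set K := planePerturbation (u a) (u b) c with hK
  have hMK : traceMul M K = 0 := hc
  have hpos : 0 < |c.1| + ‖c.2‖ := by
    rcases not_and_or.1 (mt Prod.ext_iff.2 hc0) with h2 | h2
    · exact add_pos_of_pos_of_nonneg (abs_pos.2 h2) (norm_nonneg _)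
    · exact add_pos_of_nonneg_of_pos (abs_nonneg _) (norm_pos_iff.2 h2)
  set δ := min (min (h a) (1 - h a)) (min (h b) (1 - h b)) with hδ
  have hδ0 : 0 < δ := by
    have := lt_of_le_of_ne (h0 a) ha0.symm
    have := lt_of_le_of_ne (h0 b) hb0.symm
    have := lt_of_le_of_ne (h1 a) ha1
    have := lt_of_le_of_ne (h1 b) hb1
    simp only [hδ, lt_min_iff, sub_pos]
    tauto
  set ε := δ / (|c.1| + ‖c.2‖) with hε
  have hε0 : 0 < ε := div_pos hδ0 hpos
  have hεδ : ε * (|c.1| + ‖c.2‖) = δ := div_mul_cancel₀ _ hpos.ne'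
  have hle : ∀ t : ℝ, |t| = ε → ∑ j, ‖(H + t • K) (b₀ j)‖ ^ 2 ≤ ∑ j, ‖H (b₀ j)‖ ^ 2 :=
    fun t ht => hmax ⟨add_smul_planePerturbation_mem hH hu hab ha0 ha1 hb0 hb1 c
      (by rw [ht, hεδ]; exact min_le_left _ _) (by rw [ht, hεδ]; exact min_le_right _ _),
      by simp only [Set.mem_ofPred_eq, map_add, map_smul, hMK, smul_zero, add_zero]⟩
  have hp := hle ε (abs_of_pos hε0)
  have hm := hle (-ε) (by rw [abs_neg, abs_of_pos hε0])
  -- Neither `H + εK` nor `H - εK` exceeds `H` in norm, so the parallelogram law forces `K = 0`.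
  have hpar : ∑ j, ‖(H + ε • K) (b₀ j)‖ ^ 2 + ∑ j, ‖(H + (-ε) • K) (b₀ j)‖ ^ 2 =
      2 * ∑ j, ‖H (b₀ j)‖ ^ 2 + 2 * ∑ j, ‖(ε • K) (b₀ j)‖ ^ 2 := by
    rw [← Finset.sum_add_distrib, Finset.mul_sum, Finset.mul_sum, ← Finset.sum_add_distrib]
    refine Finset.sum_congr rfl fun j _ => ?_
    rw [neg_smul, ← sub_eq_add_neg, add_apply, sub_apply]
    simpa only [mul_add] using parallelogram_law_with_norm ℂ (H (b₀ j)) ((ε • K) (b₀ j))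
  have hz : ∑ j, ‖(ε • K) (b₀ j)‖ ^ 2 = 0 :=
    le_antisymm (by linarith) (Finset.sum_nonneg fun _ _ => sq_nonneg _)
  have hK0 : (K : E →ₗ[ℂ] E) = 0 := b₀.toBasis.ext fun j => by
    have := (Finset.sum_eq_zero_iff_of_nonneg (fun _ _ => sq_nonneg _)).1 hz j (Finset.mem_univ j)
    simpa [hε0.ne'] using this
  exact hc0 (planePerturbation_eq_zero (u.norm_eq_one a) (u.norm_eq_one b)
    (u.orthonormal.2 hab) (LinearMap.congr_fun hK0 (u a)))

theorem exists_idempotent_traceMul_eq (M : E →ₗ[ℂ] E) (hH : H ∈ fractionalProjections k U V) :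
    ∃ P ∈ fractionalProjections k U V, traceMul M P = traceMul M H ∧ ∀ x, P (P x) = P x := by
  set b₀ := stdOrthonormalBasis ℂ E
  have hcomp : IsCompact (fractionalProjections k U V ∩ {K | traceMul M K = traceMul M H}) :=
    isCompact_fractionalProjections.inter_right
      (isClosed_eq (continuous_traceMul M) continuous_const)
  obtain ⟨P, ⟨hP, hPw⟩, hmax⟩ := hcomp.exists_isMaxOn ⟨H, hH, rfl⟩
    (f := fun K : E →L[ℂ] E => ∑ j, ‖K (b₀ j)‖ ^ 2) (by fun_prop)
  refine ⟨P, hP, hPw, ?_⟩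
  have hsym := fractionalProjections.isSymmetric hP
  set u := hsym.eigenvectorBasis rfl with hu_def
  set h := hsym.eigenvalues rfl with hh_def
  have hu : ∀ j, P (u j) = (h j : ℂ) • u j := hsym.apply_eigenvectorBasis rfl
  have hunit : ∀ j, (inner ℂ (P (u j)) (u j)).re = h j := fun j => by
    rw [hu, inner_smul_left, Complex.conj_ofReal, Complex.re_ofReal_mul]
    simp [inner_self_eq_norm_sq_to_K]
  have h0 : ∀ j, 0 ≤ h j := fun j => by simpa [hunit] using (hP.2.1 (u j)).1
  have h1 : ∀ j, h j ≤ 1 := fun j => by simpa [hunit] using (hP.2.1 (u j)).2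
  have hsum : ∑ j, h j = k := by
    have := hsym.trace_eq_sum_eigenvalues rfl
    rw [hP.2.2.1] at this
    refine Complex.ofReal_injective ?_
    rw [Complex.ofReal_natCast]
    exact this.symm
  have hPw' : traceMul M P = traceMul M H := hPw
  rw [← hPw'] at hmax
  have h01 : ∀ j, h j = 0 ∨ h j = 1 := by
    intro a
    by_contra! ha
    have hother : ∀ j, j ≠ a → h j = 0 ∨ h j = 1 := fun j hj =>
      eigenvalue_eq_zero_or_one_of_isMaxOn b₀ M hP hmax hu h0 h1 hj.symm ha.1 ha.2
    -- The other eigenvalues sum to an integer, as does the whole, yet `h a` lies strictly between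
    -- `0` and `1`.
    have hint : ∑ j ∈ Finset.univ.erase a, h j =
        (((Finset.univ.erase a).filter fun j => h j = 1).card : ℝ) := by
      rw [Finset.card_filter]
      push_cast
      refine Finset.sum_congr rfl fun j hj => ?_
      rcases hother j (Finset.ne_of_mem_erase hj) with h2 | h2 <;> simp [h2]
    rw [← Finset.add_sum_erase _ _ (Finset.mem_univ a), hint] at hsum
    have hlt0 := lt_of_le_of_ne (h0 a) ha.1.symm
    have hlt1 := lt_of_le_of_ne (h1 a) ha.2
    set N := ((Finset.univ.erase a).filter fun j => h j = 1).card
    have e1 : N < k := by exact_mod_cast (by linarith : (N : ℝ) < k)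
    have e2 : k < N + 1 := by exact_mod_cast (by linarith : (k : ℝ) < N + 1)
    omega
  have hext : (P : E →ₗ[ℂ] E) ∘ₗ (P : E →ₗ[ℂ] E) = P := u.toBasis.ext fun j => by
    rcases h01 j with h2 | h2 <;> simp [hu, h2]
  exact fun x => LinearMap.congr_fun hext x

theorem traceMul_sum_rankOne {ι : Type*} [Fintype ι] (M : E →ₗ[ℂ] E) (v : ι → E) :
    traceMul M (∑ i, InnerProductSpace.rankOne ℂ (v i) (v i)) =
      ∑ i, inner ℂ (v i) (M (v i)) := by
  rw [map_sum]
  refine Finset.sum_congr rfl fun i _ => ?_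
  rw [← InnerProductSpace.trace_rankOne (M (v i)) (v i), traceMul_apply]
  congr 1
  ext x
  simp

theorem sum_rankOne_mem_fractionalProjections {v : Fin k → E} (hv : Orthonormal ℂ v)
    (hU : ∀ x ∈ U, ∑ i, inner ℂ (v i) x • v i = x) (hV : ∀ x ∈ V, ∀ i, inner ℂ (v i) x = 0) :
    ∑ i, InnerProductSpace.rankOne ℂ (v i) (v i) ∈ fractionalProjections k U V := by
  have happ : ∀ x, (∑ i, InnerProductSpace.rankOne ℂ (v i) (v i)) x =
      ∑ i, inner ℂ (v i) x • v i := fun x => by simp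
  have hq : ∀ x, (inner ℂ (∑ i, inner ℂ (v i) x • v i) x).re = ∑ i, ‖inner ℂ (v i) x‖ ^ 2 :=
    fun x => by
      rw [sum_inner, Complex.re_sum]
      refine Finset.sum_congr rfl fun i _ => ?_
      rw [inner_smul_left, RCLike.conj_mul]
      norm_cast
  refine ⟨fun x y => ?_, fun x => ?_, ?_, fun x hx => ?_, fun x hx => ?_⟩
  · rw [happ, happ, sum_inner, inner_sum]
    refine Finset.sum_congr rfl fun i _ => ?_
    rw [inner_smul_left, inner_smul_right, inner_conj_symm, mul_comm]
  · rw [happ, hq]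
    exact ⟨Finset.sum_nonneg fun _ _ => sq_nonneg _, hv.sum_inner_products_le x⟩
  · rw [← traceMul_id, traceMul_sum_rankOne]
    simp [inner_self_eq_norm_sq_to_K, hv.1]
  · rw [happ, hU x hx]
  · rw [happ]
    simp [hV x hx]

/-- The range of `P` has dimension `tr P = k`, contains the prescribed `w i`, and is orthogonal to
`V` by symmetry. Extend the `w i` to an orthonormal basis of it. -/
theorem exists_orthonormal_of_idempotent {P : E →L[ℂ] E}
    (hP : P ∈ fractionalProjections k U V) (hidem : ∀ x, P (P x) = P x) (M : E →ₗ[ℂ] E)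
    {w : Fin k → E} {s : Set (Fin k)} (hw : Orthonormal ℂ (s.domRestrict w))
    (hwU : ∀ i ∈ s, w i ∈ U) :
    ∃ v : Fin k → E, Orthonormal ℂ v ∧ (∀ i ∈ s, v i = w i) ∧
      (∀ i, ∀ x ∈ V, inner ℂ x (v i) = 0) ∧ ∑ i, inner ℂ (v i) (M (v i)) = traceMul M P := by
  set S : Submodule ℂ E := LinearMap.range (P : E →ₗ[ℂ] E) with hS
  have hfix : ∀ x ∈ S, P x = x := by
    rintro _ ⟨y, rfl⟩
    exact hidem y
  have hexp : ∀ {ι : Type} [Fintype ι] (b : OrthonormalBasis ι ℂ S),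
      P = ∑ i, InnerProductSpace.rankOne ℂ (b i : E) (b i : E) := by
    intro ι _ b
    ext x
    have h1 := congrArg (Subtype.val) (b.sum_repr' ⟨P x, ⟨x, rfl⟩⟩)
    rw [Submodule.coe_sum] at h1
    simp only [Submodule.coe_smul, Submodule.coe_inner] at h1
    rw [← h1]
    simp only [sum_apply, InnerProductSpace.rankOne_apply]
    refine Finset.sum_congr rfl fun i _ => ?_
    rw [← hP.1, hfix _ (b i).2]
  have hfin : Module.finrank ℂ S = Fintype.card (Fin k) := by
    have h1 := hP.2.2.1
    rw [hexp (stdOrthonormalBasis ℂ S), ← traceMul_id, traceMul_sum_rankOne] at h1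
    have h2 : ∀ i, inner ℂ (stdOrthonormalBasis ℂ S i : E) (stdOrthonormalBasis ℂ S i : E) = 1 :=
      fun i => by
        rw [← Submodule.coe_inner, inner_self_eq_norm_sq_to_K, OrthonormalBasis.norm_eq_one]
        simp
    simp only [LinearMap.id_apply, h2] at h1
    rw [Fintype.card_fin]
    simpa using h1
  have hon : Orthonormal ℂ (s.domRestrict fun i => (⟨P (w i), ⟨w i, rfl⟩⟩ : S)) := by
    rw [← S.subtypeₗᵢ.orthonormal_comp_iff]
    convert hw using 1
    ext1 i
    exact hP.2.2.2.1 _ (hwU i i.2)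
  obtain ⟨b, hb⟩ := hon.exists_orthonormalBasis_extension_of_card_eq hfin
  refine ⟨fun i => b i, ?_, fun i hi => ?_, fun i x hx => ?_, ?_⟩
  · exact (S.subtypeₗᵢ.orthonormal_comp_iff).2 b.orthonormal
  · change (b i : E) = w i
    rw [hb i hi]
    exact hP.2.2.2.1 _ (hwU i hi)
  · change inner ℂ x (b i : E) = 0
    rw [← hfix _ (b i).2, ← hP.1, hP.2.2.2.2 x hx, inner_zero_left]
  · conv_rhs => rw [hexp b]
    rw [traceMul_sum_rankOne]

end Extreme

/-! ### Functional calculus and the two implications -/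

section Main

variable {m n : ℕ}

theorem toEuclideanLin_mul_apply {l : ℕ} (A : Matrix (Fin l) (Fin m) ℂ)
    (B : Matrix (Fin m) (Fin n) ℂ) (x : EuclideanSpace ℂ (Fin n)) :
    Matrix.toEuclideanLin (A * B) x = Matrix.toEuclideanLin A (Matrix.toEuclideanLin B x) := by
  simp [Matrix.toLpLin_apply, Matrix.mulVec_mulVec]

theorem inner_toEuclideanLin_left (A : Matrix (Fin m) (Fin n) ℂ) (x : EuclideanSpace ℂ (Fin n))
    (y : EuclideanSpace ℂ (Fin m)) :
    inner ℂ (Matrix.toEuclideanLin A x) y = inner ℂ x (Matrix.toEuclideanLin Aᴴ y) := by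
  rw [Matrix.toEuclideanLin_conjTranspose_eq_adjoint, LinearMap.adjoint_inner_right]

/-- The continuous functional calculus acts on an eigenvector through its eigenvalue. -/
theorem toEuclideanLin_cfc_apply {a : Matrix (Fin n) (Fin n) ℂ} (ha : IsSelfAdjoint a)
    (f : ℝ → ℝ) {v : EuclideanSpace ℂ (Fin n)} {μ : ℝ}
    (h : Matrix.toEuclideanLin a v = (μ : ℂ) • v) :
    Matrix.toEuclideanLin (cfc f a) v = (f μ : ℂ) • v := by
  classical
  -- The node `μ` is added because `v` may be zero, in which case `μ` need not lie in the spectrum.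
  set s : Finset ℝ := insert μ (Matrix.finite_real_spectrum (A := a)).toFinset with hs
  set q := Lagrange.interpolate s id f with hq
  have hqf : ∀ x ∈ s, q.eval x = f x := fun x hx =>
    Lagrange.eval_interpolate_at_node f Function.injective_id.injOn hx
  have hcfc : cfc f a = Polynomial.aeval a q := by
    rw [← cfc_polynomial q a ha]
    exact cfc_congr fun x hx => (hqf x (by simp [hs, hx])).symm
  have key : ∀ r : Polynomial ℝ,
      Matrix.toEuclideanLin (Polynomial.aeval a r) v = ((r.eval μ : ℝ) : ℂ) • v := fun r => by
    induction r using Polynomial.induction_on' with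
    | add r t hr ht => simp [hr, ht, add_smul]
    | monomial d c =>
      have hpow : ∀ d : ℕ, Matrix.toEuclideanLin (a ^ d) v = (μ : ℂ) ^ d • v := fun d => by
        induction d with
        | zero => simp
        | succ d ih => rw [pow_succ, toEuclideanLin_mul_apply, h, map_smul, ih, smul_smul, pow_succ']
      rw [Polynomial.aeval_monomial, ← Algebra.smul_def, Polynomial.eval_monomial,
        ← Complex.coe_smul, map_smul, LinearMap.smul_apply, hpow,
        smul_smul]
      simp
  rw [hcfc, key, hqf μ (by simp [hs])]

open scoped ComplexOrder in
theorem conjTranspose_mul_self_nonneg (A : Matrix (Fin m) (Fin n) ℂ) : 0 ≤ Aᴴ * A :=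
  (Matrix.posSemidef_conjTranspose_mul_self A).nonneg

theorem inner_toEuclideanLin_rpow_mul {p : ℝ} (A B : Matrix (Fin m) (Fin n) ℂ)
    {v : EuclideanSpace ℂ (Fin n)} {σ : ℝ} (hσ : 0 ≤ σ)
    (h : Matrix.toEuclideanLin (Aᴴ * A) v = ((σ ^ 2 : ℝ) : ℂ) • v) :
    inner ℂ v (Matrix.toEuclideanLin ((Aᴴ * A) ^ ((p - 2) / 2) * Aᴴ * B) v) =
      ((σ ^ (p - 2) : ℝ) : ℂ) *
        inner ℂ (Matrix.toEuclideanLin A v) (Matrix.toEuclideanLin B v) := by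
  have hpow : (σ ^ 2) ^ ((p - 2) / 2) = σ ^ (p - 2) := by
    rw [← Real.rpow_natCast, ← Real.rpow_mul hσ]
    congr 1
    push_cast
    ring
  have h1 := toEuclideanLin_cfc_apply (Matrix.isHermitian_conjTranspose_mul_self A)
    (fun x => x ^ ((p - 2) / 2)) h
  have hdef : (Aᴴ * A) ^ ((p - 2) / 2) = cfc (fun x : ℝ => x ^ ((p - 2) / 2)) (Aᴴ * A) :=
    CFC.rpow_eq_cfc_real (conjTranspose_mul_self_nonneg A)
  rw [← hdef, hpow] at h1
  have hsa : ((Aᴴ * A) ^ ((p - 2) / 2))ᴴ = (Aᴴ * A) ^ ((p - 2) / 2) :=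
    (IsSelfAdjoint.of_nonneg CFC.rpow_nonneg : IsSelfAdjoint ((Aᴴ * A) ^ ((p - 2) / 2)))
  rw [Matrix.mul_assoc, toEuclideanLin_mul_apply, ← hsa, ← inner_toEuclideanLin_left, h1,
    inner_smul_left, Complex.conj_ofReal, toEuclideanLin_mul_apply, inner_toEuclideanLin_left]

theorem matrixSingularValue_nonneg (A : Matrix (Fin m) (Fin n) ℂ) (i : ℕ) :
    0 ≤ matrixSingularValue A i := LinearMap.singularValues_nonneg _ i

theorem matrixSingularValue_anti (A : Matrix (Fin m) (Fin n) ℂ) :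
    Antitone (matrixSingularValue A) := LinearMap.singularValues_antitone _

theorem kyFanNorm_le_kyFanNorm_iff {p : ℝ} (hp : 0 < p) (k : ℕ) (A X : Matrix (Fin m) (Fin n) ℂ) :
    kyFanNorm p k A ≤ kyFanNorm p k X ↔
      ∑ i : Fin k, matrixSingularValue A i ^ p ≤ ∑ i : Fin k, matrixSingularValue X i ^ p := by
  have h : ∀ Y : Matrix (Fin m) (Fin n) ℂ, 0 ≤ ∑ i : Fin k, matrixSingularValue Y i ^ p :=
    fun Y => Finset.sum_nonneg fun i _ => Real.rpow_nonneg (matrixSingularValue_nonneg Y i) p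
  rw [kyFanNorm, kyFanNorm, Finset.sum_range, Finset.sum_range]
  exact Real.rpow_le_rpow_iff (h A) (h X) (by positivity)

theorem IsSingularSystem.map_eq {A : Matrix (Fin m) (Fin n) ℂ}
    {e : OrthonormalBasis (Fin n) ℂ (EuclideanSpace ℂ (Fin n))} {s : Fin n → ℝ}
    (h : IsSingularSystem (Matrix.toEuclideanLin A) e s) (i : Fin n) :
    Matrix.toEuclideanLin (Aᴴ * A) (e i) = ((s i ^ 2 : ℝ) : ℂ) • e i := by
  refine ext_inner_right ℂ fun y => ?_
  rw [inner_smul_left, Complex.conj_ofReal, ← h.inner_map, inner_toEuclideanLin_left,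
    inner_toEuclideanLin_left, Matrix.conjTranspose_mul, Matrix.conjTranspose_conjTranspose,
    toEuclideanLin_mul_apply]

theorem kyFanBirkhoffJamesOrthogonal_of_orthonormal {p : ℝ} (hp : 2 ≤ p) {k : ℕ} (hkn : k ≤ n)
    {A B : Matrix (Fin m) (Fin n) ℂ} {v : Fin k → EuclideanSpace ℂ (Fin n)}
    (hv : Orthonormal ℂ v)
    (hA : ∀ i : Fin k, Matrix.toEuclideanLin (Aᴴ * A) (v i) =
      ((matrixSingularValue A i ^ 2 : ℝ) : ℂ) • v i)
    (hsum : ∑ i : Fin k, ((matrixSingularValue A i ^ (p - 2) : ℝ) : ℂ) *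
      inner ℂ (Matrix.toEuclideanLin A (v i)) (Matrix.toEuclideanLin B (v i)) = 0) :
    KyFanBirkhoffJamesOrthogonal p k A B := by
  intro z
  rw [kyFanNorm_le_kyFanNorm_iff (by linarith)]
  have hnorm : ∀ i, ‖Matrix.toEuclideanLin A (v i)‖ = matrixSingularValue A i := fun i => by
    refine (sq_eq_sq₀ (norm_nonneg _) (matrixSingularValue_nonneg A i)).1 ?_
    rw [← inner_self_eq_norm_sq (𝕜 := ℂ), inner_toEuclideanLin_left, ← toEuclideanLin_mul_apply,
      hA, inner_smul_right, inner_self_eq_norm_sq_to_K, hv.1]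
    simp
    norm_cast
  obtain ⟨e, he⟩ := exists_isSingularSystem (A + z • B)
  refine le_trans ?_ (he.sum_norm_map_rpow_le hp hkn hv)
  have hyoung := Finset.sum_le_sum fun i (_ : i ∈ Finset.univ) =>
    norm_rpow_sub_two_mul_inner_le hp (Matrix.toEuclideanLin A (v i))
      (Matrix.toEuclideanLin (A + z • B) (v i))
  have hzero : ∑ i : Fin k, matrixSingularValue A i ^ (p - 2) *
      (z * inner ℂ (Matrix.toEuclideanLin A (v i)) (Matrix.toEuclideanLin B (v i))).re = 0 := by
    have := congrArg (fun w => (z * w).re) hsum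
    simpa only [Finset.mul_sum, Complex.re_sum, mul_left_comm z, Complex.re_ofReal_mul, mul_zero,
      Complex.zero_re] using this
  have hself : ∀ i : Fin k, matrixSingularValue A i ^ (p - 2) *
      (inner ℂ (Matrix.toEuclideanLin A (v i)) (Matrix.toEuclideanLin A (v i))).re =
        matrixSingularValue A i ^ p := fun i => by
    rw [← hnorm, norm_rpow_sub_two_mul_inner_self hp]
  simp only [map_add, map_smul, LinearMap.add_apply, LinearMap.smul_apply, inner_add_right,
    inner_smul_right, Complex.add_re, mul_add, hself,
    Finset.sum_add_distrib, ← Finset.mul_sum, hnorm, hzero, add_zero] at hyoung ⊢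
  have h1 : 0 < 1 / p := by positivity
  refine le_of_mul_le_mul_left ?_ h1
  linarith

theorem mainTheorem6 (m n : ℕ) (p : ℝ) (hp : 2 ≤ p) (k : ℕ) (hk : 1 ≤ k) (hkn : k ≤ n)
    (A B : Matrix (Fin m) (Fin n) ℂ) :
    KyFanBirkhoffJamesOrthogonal p k A B ↔
      ∃ v : Fin k → EuclideanSpace ℂ (Fin n),
        Orthonormal ℂ v ∧
        (∀ i : Fin k, Matrix.toEuclideanLin (Aᴴ * A) (v i) =
          ((matrixSingularValue A i ^ 2 : ℝ) : ℂ) • v i) ∧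
        ∑ i : Fin k,
          inner ℂ (v i) (Matrix.toEuclideanLin ((Aᴴ * A) ^ ((p - 2) / 2) * Aᴴ * B) (v i)) = 0 := by
  set M := Matrix.toEuclideanLin ((Aᴴ * A) ^ ((p - 2) / 2) * Aᴴ * B) with hM
  set σ := matrixSingularValue A with hσ
  have hanti : Antitone σ := matrixSingularValue_anti A
  constructor
  · intro h
    obtain ⟨e, he⟩ := exists_isSingularSystem A
    -- Indices start at `0`, so this is the `k`-th singular value; only its eigenspace leaves a
    -- choice of vectors.
    set τ := σ (k - 1) with hτ
    set U : Set (EuclideanSpace ℂ (Fin n)) := {x | ∃ j : Fin n, τ < σ j ∧ x = e j} with hU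
    set V : Set (EuclideanSpace ℂ (Fin n)) := {x | ∃ j : Fin n, σ j < τ ∧ x = e j} with hV
    have hdir : ∀ z : ℂ, ∃ H ∈ fractionalProjections k U V, 0 ≤ (z * traceMul M H).re := by
      intro z
      obtain ⟨v, hvs, hre⟩ := exists_isSingularSystem_re_nonneg hp hkn A (z • B) fun t _ => by
        rw [smul_smul]
        exact (kyFanNorm_le_kyFanNorm_iff (by linarith) k _ _).1 (h _)
      set w : Fin k → EuclideanSpace ℂ (Fin n) := fun i => v (Fin.castLE hkn i) with hw
      refine ⟨∑ i, InnerProductSpace.rankOne ℂ (w i) (w i),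
        sum_rankOne_mem_fractionalProjections
          (v.orthonormal.comp _ (Fin.castLE_injective hkn)) ?_ ?_, ?_⟩
      -- For `i ≥ k` the value `σ i ≤ τ` differs from `σ j`, so `e j` expands in the first `k`
      -- vectors alone.
      · rintro _ ⟨j, hj, rfl⟩
        rw [← Fin.sum_ite_val_lt_eq_sum_castLE hkn fun i => inner ℂ (v i) (e j) • v i]
        conv_rhs => rw [← v.sum_repr' (e j)]
        refine Finset.sum_congr rfl fun i _ => ?_
        split_ifs with hi
        · rfl
        · have : σ i ≤ τ := hanti (by omega)
          rw [hvs.inner_eq_zero he (this.trans_lt hj).ne, zero_smul]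
      · rintro _ ⟨j, hj, rfl⟩ i
        have : τ ≤ σ i := hanti (by omega)
        exact hvs.inner_eq_zero he (hj.trans_le this).ne'
      · rw [traceMul_sum_rankOne, Finset.mul_sum, Complex.re_sum]
        refine hre.trans_eq (Finset.sum_congr rfl fun i _ => ?_)
        rw [hM, inner_toEuclideanLin_rpow_mul A B (matrixSingularValue_nonneg A _)
          (hvs.map_eq (Fin.castLE hkn i)), mul_left_comm, Complex.re_ofReal_mul, map_smul,
          LinearMap.smul_apply, inner_smul_right]
        rfl
    obtain ⟨H, hH, hH0⟩ := exists_traceMul_eq_zero M hdir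
    obtain ⟨P, hP, hPH, hidem⟩ := exists_idempotent_traceMul_eq M hH
    have hon : Orthonormal ℂ ({i : Fin k | τ < σ i}.domRestrict fun i => e (Fin.castLE hkn i)) :=
      e.orthonormal.comp _ ((Fin.castLE_injective hkn).comp Subtype.val_injective)
    obtain ⟨v, hv, hve, hvV, hvM⟩ :=
      exists_orthonormal_of_idempotent hP hidem M hon fun i hi => ⟨Fin.castLE hkn i, hi, rfl⟩
    refine ⟨v, hv, fun i => ?_, by rw [hvM, hPH, hH0]⟩
    by_cases hi : τ < σ i
    · rw [hve i hi]
      exact he.map_eq _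
    -- Here `v i` must lie in the eigenspace of `τ ^ 2`: `V` removes the smaller values, and each `e
    -- j` with a larger value is another member of the family `v`.
    · have hi' : σ i = τ := le_antisymm (not_lt.1 hi) (hanti (by omega))
      rw [← e.sum_repr' (v i), map_sum, Finset.smul_sum]
      refine Finset.sum_congr rfl fun j _ => ?_
      rw [map_smul, he.map_eq, smul_comm]
      rcases lt_trichotomy (σ j) τ with hj | hj | hj
      · rw [hvV i _ ⟨j, hj, rfl⟩, zero_smul, smul_zero, smul_zero]
      · rw [hi', ← hj]
      · have hjk : (j : ℕ) < k := by
          by_contra hjk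
          exact hj.not_ge (hanti (by omega))
        have hj' : v ⟨j, hjk⟩ = e j := hve ⟨j, hjk⟩ hj
        have hne : (⟨j, hjk⟩ : Fin k) ≠ i := by
          rintro rfl
          exact hi hj
        rw [← hj', hv.2 hne, zero_smul, smul_zero, smul_zero]
  · rintro ⟨v, hv, hA, hsum⟩
    refine kyFanBirkhoffJamesOrthogonal_of_orthonormal hp hkn hv hA ?_
    rw [← hsum]
    exact Finset.sum_congr rfl fun i _ =>
      (inner_toEuclideanLin_rpow_mul A B (matrixSingularValue_nonneg A _) (hA i)).symm

end Main
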